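/- For a two-qubit state $\rho_{kl}$ (sender holding qubit $k$, receiver qubit $l$) let $C(\rho_{kl})=1+S(\rho_l)-S(\rho_{kl})$ be its dense coding capacity, where $S(\rho)=-\mathrm{Tr}(\rho\log_2\rho)$ is the von Neumann entropy and $\rho_l=\mathrm{Tr}_k\,\rho_{kl}$. For a three-qubit state $\rho_{123}$ and a permutation $(j,k,l)$ of $(1,2,3)$, the control power of the holder of qubit $j$ is $$P^{jkl}(\rho_{123})=\max_U\sum_{i=0}^{1}p_i\,C(\rho^i_{kl})-C(\rho_{kl}),\qquad p_i=\langle i|U\rho_jU^\dagger|i\rangle ,$$ where the maximum is over all $2\times2$ unitary matrices $U$, $\rho_j$ and $\rho_{kl}$ are the reduced states of $\rho_{123}$, and $\rho^i_{kl}=\langle i|U_j\,\rho_{123}\,U_j^\dagger|i\rangle_j/p_i$ is the state of qubits $k,l$ after outcome $i$ of the measurement of qubit $j$ in the basis given by $U$, with $U_j$ denoting $U$ acting on qubit $j$ (outcomes with $p_i=0$ contribute $0$). The minimal control power is $P(\rho_{123})=\min_{(j,k,l)}P^{jkl}(\rho_{123})$, the minimum over all six permutations. Proposition. Let $\rho_{123}$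 be a pure three-qubit state. Then $P(\rho_{123})=1$ if and only if $\rho_{123}$ is, up to local unitaries, the standard GHZ state, i.e. if and only if there are $2\times 2$ unitary matrices $U_1,U_2,U_3$ with $$\rho_{123}=(U_1\otimes U_2\otimes U_3)\,|\mathrm{GHZ}\rangle\langle \mathrm{GHZ}|\,(U_1\otimes U_2\otimes U_3)^\dagger,\qquad |\mathrm{GHZ}\rangle=\frac{|000\rangle+|111\rangle}{\sqrt2}.$$ -/

import Mathlib

open scoped Matrix Kronecker ComplexOrder

noncomputable section

namespace ControlledDenseCoding

/-- Pure states `|ψ⟩⟨ψ|` with `ψ` a unit vector. -/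
def IsPureState {n : Type*} [Fintype n] (ρ : Matrix n n ℂ) : Prop :=
  ∃ ψ : n → ℂ, ∑ i, ‖ψ i‖ ^ 2 = 1 ∧ ρ = Matrix.vecMulVec ψ (star ψ)

/-- The von Neumann entropy `S(ρ) = - Tr (ρ log₂ ρ)` in bits, where `- x log₂ x` is applied to the
Hermitian matrix `ρ` by functional calculus (and `0 log₂ 0 = 0`). -/
def entropy {n : Type*} [Fintype n] [DecidableEq n] (ρ : Matrix n n ℂ) : ℝ :=
  (cfc (fun x : ℝ => -(x * Real.logb 2 x)) ρ).trace.re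

/-- Partial trace over the first tensor factor. -/
def traceFst {m n : Type*} [Fintype m] (ρ : Matrix (m × n) (m × n) ℂ) : Matrix n n ℂ :=
  Matrix.of fun x y => ∑ a, ρ (a, x) (a, y)

/-- Partial trace over the second tensor factor. -/
def traceSnd {m n : Type*} [Fintype n] (ρ : Matrix (m × n) (m × n) ℂ) : Matrix m m ℂ :=
  Matrix.of fun a b => ∑ x, ρ (a, x) (b, x)

/-- The dense coding channel capacity `1 + S(ρ_l) - S(ρ_kl)` of a two-qubit state; the sender holds
the first tensor factor and the receiver the second. -/
def capacity (ρ : Matrix (Fin 2 × Fin 2) (Fin 2 × Fin 2) ℂ) : ℝ :=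
  1 + entropy (traceFst ρ) - entropy ρ

/-- Operators on three qubits. The computational basis vector `|f 0, f 1, f 2⟩` is indexed by
`f : Fin 3 → Fin 2`. -/
abbrev ThreeQubitOp := Matrix (Fin 3 → Fin 2) (Fin 3 → Fin 2) ℂ

/-- Operators on the tensor product of Charlie's qubit with Alice's and Bob's qubits. -/
abbrev CharlieAliceBobOp := Matrix (Fin 2 × (Fin 2 × Fin 2)) (Fin 2 × (Fin 2 × Fin 2)) ℂ

/-- Distribution of the three qubits: Charlie gets qubit `j = σ 0`, Alice `k = σ 1`, and
Bob `l = σ 2`. -/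
def distribute (σ : Equiv.Perm (Fin 3)) (ρ : ThreeQubitOp) : CharlieAliceBobOp :=
  ρ.submatrix (fun p i => ![p.1, p.2.1, p.2.2] (σ.symm i))
    (fun p i => ![p.1, p.2.1, p.2.2] (σ.symm i))

/-- The probability `⟨i|U ρ_j U†|i⟩` of Charlie's outcome `i`. -/
def outcomeProb (U : Matrix.unitaryGroup (Fin 2) ℂ) (ρ : CharlieAliceBobOp) (i : Fin 2) : ℝ :=
  ((U : Matrix (Fin 2) (Fin 2) ℂ) * traceSnd ρ * (U : Matrix (Fin 2) (Fin 2) ℂ)ᴴ) i i |>.re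

/-- The unnormalised state `⟨i|(U ⊗ 1) ρ (U ⊗ 1)†|i⟩` of Alice and Bob after the outcome `i`. -/
def unnormalizedPostState (U : Matrix.unitaryGroup (Fin 2) ℂ) (ρ : CharlieAliceBobOp) (i : Fin 2) :
    Matrix (Fin 2 × Fin 2) (Fin 2 × Fin 2) ℂ :=
  (((U : Matrix (Fin 2) (Fin 2) ℂ) ⊗ₖ (1 : Matrix (Fin 2 × Fin 2) (Fin 2 × Fin 2) ℂ)) * ρ *
    ((U : Matrix (Fin 2) (Fin 2) ℂ) ⊗ₖ (1 : Matrix (Fin 2 × Fin 2) (Fin 2 × Fin 2) ℂ))ᴴ).submatrix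
      (fun x => (i, x)) (fun x => (i, x))

/-- The state `ρ_kl^i` that Alice and Bob share after Charlie's outcome `i` (relevant only if the
outcome has positive probability; otherwise it enters with weight zero below). -/
def postState (U : Matrix.unitaryGroup (Fin 2) ℂ) (ρ : CharlieAliceBobOp) (i : Fin 2) :
    Matrix (Fin 2 × Fin 2) (Fin 2 × Fin 2) ℂ :=
  (outcomeProb U ρ i)⁻¹ • unnormalizedPostState U ρ i

/-- Average capacity when Charlie measures in the basis given by `U`. -/
def averageCapacity (U : Matrix.unitaryGroup (Fin 2) ℂ) (ρ : CharlieAliceBobOp) : ℝ :=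
  ∑ i, outcomeProb U ρ i * capacity (postState U ρ i)

/-- The controlled dense coding capacity: the largest average capacity over all measurement bases.
The lemma `exists_isMaxOn_averageCapacity` shows that for states the supremum is a maximum. -/
def controlledCapacity (ρ : CharlieAliceBobOp) : ℝ :=
  ⨆ U : Matrix.unitaryGroup (Fin 2) ℂ, averageCapacity U ρ

/-- The control power of Charlie for the distribution `σ = (j, k, l)` of the qubits. -/
def controlPower (σ : Equiv.Perm (Fin 3)) (ρ : ThreeQubitOp) : ℝ :=
  controlledCapacity (distribute σ ρ) - capacity (traceFst (distribute σ ρ))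

/-- The minimal control power: the minimum over all six distributions of the qubits. -/
def minimalControlPower (ρ : ThreeQubitOp) : ℝ :=
  Finset.univ.inf' Finset.univ_nonempty fun σ : Equiv.Perm (Fin 3) => controlPower σ ρ

/-- The vector `(|000⟩ + |111⟩)/√2`. -/
def ghzVector : (Fin 3 → Fin 2) → ℂ :=
  ((1 / Real.sqrt 2 : ℝ) : ℂ) • (Pi.single (fun _ => 0) 1 + Pi.single (fun _ => 1) 1)

/-- The standard GHZ state. -/
def ghzState : ThreeQubitOp := Matrix.vecMulVec ghzVector (star ghzVector)

/-- The local unitary `U 0 ⊗ U 1 ⊗ U 2`. -/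
def localUnitary (U : Fin 3 → Matrix.unitaryGroup (Fin 2) ℂ) : ThreeQubitOp :=
  Matrix.of fun f g => ∏ i, (U i : Matrix (Fin 2) (Fin 2) ℂ) (f i) (g i)




/-! ### The supremum in `controlledCapacity` is attained -/

section Attainment

lemma continuous_neg_mul_logb : Continuous fun x : ℝ => -(x * Real.logb 2 x) := by
  have h := (Real.continuous_mul_log.div_const (Real.log 2)).neg
  refine h.congr fun x => ?_
  simp only [Pi.neg_apply, Real.logb, mul_div_assoc]

open scoped Matrix.Norms.L2Operator in
lemma continuous_entropy_comp {X n : Type*} [TopologicalSpace X] [Fintype n] [DecidableEq n]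
    (a : X → Matrix n n ℂ) (ha : Continuous a) (hh : ∀ x, (a x).IsHermitian) :
    Continuous fun x => entropy (a x) := by
  have hη := continuous_neg_mul_logb
  have h1 : Continuous fun x => cfc (fun x : ℝ => -(x * Real.logb 2 x)) (a x) :=
    Continuous.cfc_of_mem_nhdsSet (s := Set.univ) _ Filter.univ_mem ha
      (fun x => (hh x).isSelfAdjoint) hη.continuousOn
  exact Complex.continuous_re.comp h1.matrix_trace

lemma mul_entropy_inv_smul {n : Type*} [Fintype n] [DecidableEq n] (A : Matrix n n ℂ)
    (hA : A.IsHermitian) (r : ℝ) (hr : r ≠ 0) :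
    r * entropy (r⁻¹ • A) = entropy A + Real.logb 2 r * A.trace.re := by
  have hs : IsSelfAdjoint A := hA.isSelfAdjoint
  have hη := continuous_neg_mul_logb
  have h1 : r • cfc (fun x : ℝ => -(x * Real.logb 2 x)) (r⁻¹ • A) =
      cfc (fun x : ℝ => -(x * Real.logb 2 x)) A + Real.logb 2 r • A := by
    rw [← cfc_comp_const_mul r⁻¹ _ A hη.continuousOn hs, ← cfc_const_mul_id (Real.logb 2 r) A hs,
      ← cfc_const_mul r _ A
        (show Continuous fun x : ℝ => -(r⁻¹ * x * Real.logb 2 (r⁻¹ * x)) from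
          hη.comp (continuous_const_mul r⁻¹)).continuousOn,
      ← cfc_add (a := A) _ _ hη.continuousOn (by fun_prop)]
    congr 1
    funext x
    rcases eq_or_ne x 0 with rfl | hx
    · simp
    · rw [Real.logb_mul (inv_ne_zero hr) hx, Real.logb_inv]
      field_simp
      ring
  have h2 := congrArg (fun M : Matrix n n ℂ => M.trace.re) h1
  simpa [entropy, Matrix.trace_smul, Matrix.trace_add] using h2

lemma traceFst_smul {m n : Type*} [Fintype m] (r : ℝ) (A : Matrix (m × n) (m × n) ℂ) :
    traceFst (r • A) = r • traceFst A := by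
  ext x y
  simp [traceFst, Finset.mul_sum]

lemma trace_traceFst {m n : Type*} [Fintype m] [Fintype n] (A : Matrix (m × n) (m × n) ℂ) :
    (traceFst A).trace = A.trace := by
  simp only [traceFst, Matrix.trace, Matrix.diag, Matrix.of_apply, Fintype.sum_prod_type]
  exact Finset.sum_comm

lemma isHermitian_traceFst {m n : Type*} [Fintype m] (A : Matrix (m × n) (m × n) ℂ)
    (hA : A.IsHermitian) : (traceFst A).IsHermitian := by
  ext x y
  simp [traceFst, Matrix.conjTranspose_apply, fun a b => hA.apply a b]

lemma trace_unnormalizedPostState (U : Matrix.unitaryGroup (Fin 2) ℂ) (ρ : CharlieAliceBobOp)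
    (i : Fin 2) : (unnormalizedPostState U ρ i).trace.re = outcomeProb U ρ i := by
  rw [outcomeProb]
  congr 1
  simp only [unnormalizedPostState, traceSnd, Matrix.trace, Matrix.diag, Matrix.submatrix_apply,
    Matrix.mul_apply, Matrix.of_apply, Matrix.conjTranspose_apply, Fintype.sum_prod_type,
    Matrix.kroneckerMap_apply, Fin.sum_univ_two, Matrix.one_apply]
  simp
  ring

lemma posSemidef_unnormalizedPostState (U : Matrix.unitaryGroup (Fin 2) ℂ)
    (ρ : CharlieAliceBobOp) (hρ : ρ.PosSemidef) (i : Fin 2) :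
    (unnormalizedPostState U ρ i).PosSemidef :=
  (hρ.mul_mul_conjTranspose_same _).submatrix _

lemma outcomeProb_mul_capacity (U : Matrix.unitaryGroup (Fin 2) ℂ) (ρ : CharlieAliceBobOp)
    (hρ : ρ.PosSemidef) (i : Fin 2) :
    outcomeProb U ρ i * capacity (postState U ρ i) =
      outcomeProb U ρ i + entropy (traceFst (unnormalizedPostState U ρ i)) -
        entropy (unnormalizedPostState U ρ i) := by
  have hA := posSemidef_unnormalizedPostState U ρ hρ i
  have ht := trace_unnormalizedPostState U ρ i
  set A := unnormalizedPostState U ρ i with hAdef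
  rcases eq_or_ne (outcomeProb U ρ i) 0 with h0 | h0
  · have htr : A.trace = 0 := by
      have := hA.trace_nonneg
      apply Complex.ext
      · simpa [h0] using ht
      · simpa using ((Complex.le_def.1 this).2).symm
    have hz : A = 0 := hA.trace_eq_zero_iff.1 htr
    have hz' : traceFst A = 0 := by
      rw [hz]; ext; simp [traceFst]
    rw [hz', hz, h0]
    simp [entropy, cfc_apply_zero]
  · have h1 := mul_entropy_inv_smul A hA.isHermitian _ h0
    have h2 := mul_entropy_inv_smul (traceFst A) (isHermitian_traceFst A hA.isHermitian) _ h0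
    rw [trace_traceFst] at h2
    rw [capacity, postState, ← hAdef, traceFst_smul, mul_sub, mul_add, h1, h2]
    ring

lemma continuous_averageCapacity (ρ : CharlieAliceBobOp) (hρ : ρ.PosSemidef) :
    Continuous fun U => averageCapacity U ρ := by
  unfold averageCapacity
  refine continuous_finsetSum _ fun i _ => ?_
  simp_rw [fun U => outcomeProb_mul_capacity U ρ hρ i]
  have hU : Continuous fun U : Matrix.unitaryGroup (Fin 2) ℂ =>
      unnormalizedPostState U ρ i := by
    unfold unnormalizedPostState
    refine continuous_matrix fun x y => ?_
    simp only [Matrix.submatrix_apply, Matrix.mul_apply, Matrix.conjTranspose_apply,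
      Matrix.kroneckerMap_apply]
    have : ∀ a b, Continuous fun U : Matrix.unitaryGroup (Fin 2) ℂ =>
      (U : Matrix (Fin 2) (Fin 2) ℂ) a b := fun a b => continuous_subtype_val.matrix_elem a b
    refine continuous_finsetSum _ fun j _ => Continuous.mul
      (continuous_finsetSum _ fun k _ => ((this _ _).mul continuous_const).mul continuous_const) ?_
    exact ((this _ _).mul continuous_const).star
  have hT : Continuous fun U : Matrix.unitaryGroup (Fin 2) ℂ =>
      traceFst (unnormalizedPostState U ρ i) := by
    refine continuous_matrix fun x y => ?_
    simp only [traceFst, Matrix.of_apply]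
    exact continuous_finsetSum _ fun a _ => hU.matrix_elem _ _
  have hp : Continuous fun U : Matrix.unitaryGroup (Fin 2) ℂ => outcomeProb U ρ i := by
    simp_rw [← fun U => trace_unnormalizedPostState U ρ i]
    exact Complex.continuous_re.comp hU.matrix_trace
  have hH := fun U => (posSemidef_unnormalizedPostState U ρ hρ i).isHermitian
  exact (hp.add (continuous_entropy_comp _ hT fun U => isHermitian_traceFst _ (hH U))).sub
    (continuous_entropy_comp _ hU hH)

lemma compactSpace_unitaryGroup : CompactSpace (Matrix.unitaryGroup (Fin 2) ℂ) := by
  refine isCompact_iff_compactSpace.1 ?_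
  have hK : IsCompact (Set.univ.pi fun _ : Fin 2 => Set.univ.pi fun _ : Fin 2 =>
      Metric.closedBall (0 : ℂ) 1) :=
    isCompact_univ_pi fun _ => isCompact_univ_pi fun _ => isCompact_closedBall 0 1
  refine IsCompact.of_isClosed_subset (X := Matrix (Fin 2) (Fin 2) ℂ) hK (isClosed_unitary) ?_
  intro U hU i _ j _
  simpa using entry_norm_bound_of_unitary hU i j

/-- For a positive semidefinite `ρ`, in particular for a state, some measurement basis attains the
maximal average capacity. -/
theorem exists_isMaxOn_averageCapacity (ρ : CharlieAliceBobOp) (hρ : ρ.PosSemidef) :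
    ∃ U, IsGreatest (Set.range fun V => averageCapacity V ρ) (averageCapacity U ρ) ∧
      controlledCapacity ρ = averageCapacity U ρ := by
  have := compactSpace_unitaryGroup
  obtain ⟨U, -, hU⟩ := isCompact_univ.exists_isMaxOn Set.univ_nonempty
    (continuous_averageCapacity ρ hρ).continuousOn
  have hg : IsGreatest (Set.range fun V => averageCapacity V ρ) (averageCapacity U ρ) :=
    ⟨⟨U, rfl⟩, by rintro _ ⟨V, rfl⟩; exact hU (Set.mem_univ V)⟩
  exact ⟨U, hg, hg.csSup_eq⟩

end Attainment

end ControlledDenseCoding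

end

open scoped Matrix Kronecker ComplexOrder

noncomputable section

namespace ControlledDenseCoding

/-! ### Entropy and eigenvalues -/

/-! Measuring one qubit of a pure state leaves a pure pair, so an outcome has capacity 1 +
S(receiver) ≤ 2. Hence the controlled capacity is at most 2, and it equals 2 exactly when some basis
leaves the receiver's qubit maximally mixed after every outcome of nonzero probability
(`controlledCapacity_eq_two_iff`); averaging over outcomes, ρ_l is then itself maximally mixed.

By purity S(ρ_kl) = S(ρ_j), so P^{jkl} is the controlled capacity minus 1 + S(ρ_l) - S(ρ_j). Letting
the qubit of least entropy control shows that P = 1 forces all three entropies to be 1 and all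
controlled capacities to be 2; the converse is direct (`minimalControlPower_eq_one_iff`).

If moreover ρ_j = 1/2, both outcomes have probability 1/2 and their coefficient matrices are N₀/2,
N₁/2 with N₀, N₁ unitary and Tr(N₀†N₁) = 0. A traceless unitary qubit operator is V diag(e, -e) V†,
so N₀ and N₁ are diagonal in a common pair of bases. This is a GHZ decomposition
(`exists_eq_ghzAmplitude`). Conversely, a Hadamard-type measurement on a GHZ orbit vector leaves
maximally entangled pairs (`controlledCapacity_ghzAmplitude`). -/

lemma entropy_eq_sum_roots {n : Type*} [Fintype n] [DecidableEq n] {A : Matrix n n ℂ}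
    (hA : A.IsHermitian) :
    entropy A = (A.charpoly.roots.map fun z : ℂ => -(z.re * Real.logb 2 z.re)).sum := by
  rw [hA.roots_charpoly_eq_eigenvalues, entropy, hA.cfc_eq, Matrix.IsHermitian.cfc,
    Unitary.conjStarAlgAut_apply, Matrix.trace_mul_cycle, Unitary.coe_star_mul_self, one_mul,
    Matrix.trace_diagonal]
  simp

lemma entropy_eq_sum_eigenvalues {n : Type*} [Fintype n] [DecidableEq n] {A : Matrix n n ℂ}
    (hA : A.IsHermitian) :
    entropy A = ∑ i, -(hA.eigenvalues i * Real.logb 2 (hA.eigenvalues i)) := by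
  rw [entropy_eq_sum_roots hA, hA.roots_charpoly_eq_eigenvalues]
  simp

lemma entropy_transpose {n : Type*} [Fintype n] [DecidableEq n] {A : Matrix n n ℂ}
    (hA : A.IsHermitian) : entropy Aᵀ = entropy A := by
  rw [entropy_eq_sum_roots hA, entropy_eq_sum_roots hA.transpose, Matrix.charpoly_transpose]

/-- The nonzero spectra of `M Mᴴ` and `Mᴴ M` agree, hence so do the entropies. -/
lemma entropy_mul_conjTranspose_comm {m n : Type*} [Fintype m] [DecidableEq m] [Fintype n]
    [DecidableEq n] (M : Matrix m n ℂ) : entropy (M * Mᴴ) = entropy (Mᴴ * M) := by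
  rw [entropy_eq_sum_roots (Matrix.isHermitian_mul_conjTranspose_self M),
    entropy_eq_sum_roots (Matrix.isHermitian_conjTranspose_mul_self M)]
  -- The two characteristic polynomials agree up to powers of X; the extra zero roots contribute 0
  -- log 0 = 0.
  have h := congrArg Polynomial.roots (Matrix.charpoly_mul_comm' M Mᴴ)
  rw [Polynomial.roots_mul (mul_ne_zero (pow_ne_zero _ Polynomial.X_ne_zero)
      (Matrix.charpoly_monic _).ne_zero),
    Polynomial.roots_mul (mul_ne_zero (pow_ne_zero _ Polynomial.X_ne_zero)
      (Matrix.charpoly_monic _).ne_zero), Polynomial.roots_X_pow, Polynomial.roots_X_pow] at h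
  have h' := congrArg
    (fun s : Multiset ℂ => (s.map fun z : ℂ => -(z.re * Real.logb 2 z.re)).sum) h
  simpa [Multiset.map_nsmul, Multiset.sum_nsmul] using h'

lemma entropy_vecMulVec {n : Type*} [Fintype n] [DecidableEq n] (φ : n → ℂ)
    (hφ : ∑ i, ‖φ i‖ ^ 2 = 1) : entropy (Matrix.vecMulVec φ (star φ)) = 0 := by
  -- As a column times its adjoint, the projection has the entropy of the 1 × 1 identity.
  have h1 : Matrix.vecMulVec φ (star φ) =
      Matrix.replicateCol Unit φ * (Matrix.replicateCol Unit φ)ᴴ := by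
    ext i j
    simp [Matrix.vecMulVec_apply, Matrix.mul_apply]
  have h2 : (Matrix.replicateCol Unit φ)ᴴ * Matrix.replicateCol Unit φ = 1 := by
    ext i j
    have : ∑ i, star (φ i) * φ i = ((∑ i, ‖φ i‖ ^ 2 : ℝ) : ℂ) := by
      push_cast
      exact Finset.sum_congr rfl fun i _ => by
        simpa using Complex.conj_mul' (φ i)
    rw [hφ] at this
    simpa [Matrix.mul_apply] using this
  rw [h1, entropy_mul_conjTranspose_comm, h2, entropy]
  simp [cfc_apply_one]

/-! ### Entropy of a qubit -/

lemma qubit_entropy_eq_binEntropy {A : Matrix (Fin 2) (Fin 2) ℂ} (hA : A.IsHermitian)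
    (ht : A.trace = 1) :
    entropy A = Real.binEntropy (hA.eigenvalues 0) / Real.log 2 ∧
      hA.eigenvalues 1 = 1 - hA.eigenvalues 0 := by
  have h := hA.trace_eq_sum_eigenvalues
  rw [ht, Fin.sum_univ_two] at h
  have h1 : hA.eigenvalues 1 = 1 - hA.eigenvalues 0 := by
    have := congrArg Complex.re h
    simp at this
    linarith
  refine ⟨?_, h1⟩
  rw [entropy_eq_sum_eigenvalues hA, Fin.sum_univ_two, h1,
    Real.binEntropy_eq_negMulLog_add_negMulLog_one_sub]
  simp only [Real.negMulLog, Real.logb]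
  ring

lemma qubit_entropy_le_one {A : Matrix (Fin 2) (Fin 2) ℂ} (hA : A.IsHermitian)
    (ht : A.trace = 1) : entropy A ≤ 1 := by
  rw [(qubit_entropy_eq_binEntropy hA ht).1, div_le_one (Real.log_pos one_lt_two)]
  exact Real.binEntropy_le_log_two

lemma entropy_half_one : entropy ((1 / 2 : ℂ) • (1 : Matrix (Fin 2) (Fin 2) ℂ)) = 1 := by
  have hr : ((1 / 2 : ℂ) • (1 : Matrix (Fin 2) (Fin 2) ℂ)) =
      algebraMap ℝ (Matrix (Fin 2) (Fin 2) ℂ) (1 / 2) := by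
    rw [Algebra.algebraMap_eq_smul_one]
    ext i j
    simp
  rw [hr, entropy, cfc_algebraMap]
  simp [Matrix.trace, Matrix.algebraMap_matrix_apply]

lemma qubit_entropy_eq_one_iff {A : Matrix (Fin 2) (Fin 2) ℂ} (hA : A.IsHermitian)
    (ht : A.trace = 1) :
    entropy A = 1 ↔ A = (1 / 2 : ℂ) • (1 : Matrix (Fin 2) (Fin 2) ℂ) := by
  refine ⟨fun h => ?_, fun h => h ▸ entropy_half_one⟩
  obtain ⟨he, h1⟩ := qubit_entropy_eq_binEntropy hA ht
  rw [he, div_eq_one_iff_eq (Real.log_pos one_lt_two).ne', Real.binEntropy_eq_log_two] at h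
  have hd : (RCLike.ofReal ∘ hA.eigenvalues : Fin 2 → ℂ) = fun _ => (1 / 2 : ℂ) := by
    funext i
    fin_cases i
    · simp [h]
    · simp [h1, h]; norm_num
  have hs := hA.spectral_theorem
  rw [hd, show Matrix.diagonal (fun _ : Fin 2 => (1 / 2 : ℂ)) =
    (1 / 2 : ℂ) • (1 : Matrix (Fin 2) (Fin 2) ℂ) by
      rw [Matrix.smul_one_eq_diagonal], map_smul, map_one] at hs
  exact hs

/-! ### Measuring the first qubit of a pure state -/

/-- The unnormalised vector of the remaining qubits after outcome `i`. -/
def postVec (U : Matrix.unitaryGroup (Fin 2) ℂ) (Ψ : Fin 2 × (Fin 2 × Fin 2) → ℂ) (i : Fin 2) :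
    Fin 2 × Fin 2 → ℂ :=
  fun x => ∑ a, (U : Matrix (Fin 2) (Fin 2) ℂ) i a * Ψ (a, x)

lemma unnormalizedPostState_vecMulVec (U : Matrix.unitaryGroup (Fin 2) ℂ)
    (Ψ : Fin 2 × (Fin 2 × Fin 2) → ℂ) (i : Fin 2) :
    unnormalizedPostState U (Matrix.vecMulVec Ψ (star Ψ)) i =
      Matrix.vecMulVec (postVec U Ψ i) (star (postVec U Ψ i)) := by
  have h : ∀ x, (((U : Matrix (Fin 2) (Fin 2) ℂ) ⊗ₖ
      (1 : Matrix (Fin 2 × Fin 2) (Fin 2 × Fin 2) ℂ)) *ᵥ Ψ) (i, x) = postVec U Ψ i x := by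
    intro x
    simp [Matrix.mulVec, dotProduct, Fintype.sum_prod_type (γ := ℂ) (α₁ := Fin 2)
      (α₂ := Fin 2 × Fin 2), postVec, Matrix.kroneckerMap_apply, Matrix.one_apply]
  ext x y
  rw [unnormalizedPostState, Matrix.mul_vecMulVec, Matrix.vecMulVec_mul, ← Matrix.star_mulVec]
  simp [Matrix.vecMulVec_apply, h]

lemma trace_vecMulVec_star {n : Type*} [Fintype n] (φ : n → ℂ) :
    (Matrix.vecMulVec φ (star φ)).trace = ((∑ i, ‖φ i‖ ^ 2 : ℝ) : ℂ) := by
  push_cast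
  exact Finset.sum_congr rfl fun i _ => by
    simpa [Matrix.vecMulVec_apply] using Complex.mul_conj' (φ i)

lemma outcomeProb_vecMulVec (U : Matrix.unitaryGroup (Fin 2) ℂ)
    (Ψ : Fin 2 × (Fin 2 × Fin 2) → ℂ) (i : Fin 2) :
    outcomeProb U (Matrix.vecMulVec Ψ (star Ψ)) i = ∑ x, ‖postVec U Ψ i x‖ ^ 2 := by
  rw [← trace_unnormalizedPostState, unnormalizedPostState_vecMulVec, trace_vecMulVec_star,
    Complex.ofReal_re]

/-- Completeness of the measurement, U†U = 1: forgetting the outcome is the same as tracing out the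
measured qubit. -/
lemma sum_unnormalizedPostState (U : Matrix.unitaryGroup (Fin 2) ℂ)
    (Ψ : Fin 2 × (Fin 2 × Fin 2) → ℂ) :
    ∑ i, unnormalizedPostState U (Matrix.vecMulVec Ψ (star Ψ)) i =
      traceFst (Matrix.vecMulVec Ψ (star Ψ)) := by
  have hU : ∀ a b, ∑ i, (U : Matrix (Fin 2) (Fin 2) ℂ) i a *
      star ((U : Matrix (Fin 2) (Fin 2) ℂ) i b) = if a = b then 1 else 0 := by
    intro a b
    have := congrFun (congrFun (Matrix.mem_unitaryGroup_iff'.1 U.2) b) a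
    simp only [Matrix.mul_apply, Matrix.star_apply, Matrix.one_apply] at this
    exact (Finset.sum_congr rfl fun i _ => mul_comm _ _).trans
      (this.trans (if_congr eq_comm rfl rfl))
  ext x y
  simp only [unnormalizedPostState_vecMulVec, Matrix.sum_apply, Matrix.vecMulVec_apply, traceFst,
    Matrix.of_apply, Pi.star_apply, postVec, star_sum, star_mul', Finset.sum_mul_sum]
  rw [Finset.sum_comm]
  refine Finset.sum_congr rfl fun a _ => ?_
  rw [Finset.sum_comm]
  have : ∀ b, ∑ i, (U : Matrix (Fin 2) (Fin 2) ℂ) i a * Ψ (a, x) *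
      (star ((U : Matrix (Fin 2) (Fin 2) ℂ) i b) * star (Ψ (b, y))) =
      (if a = b then 1 else 0) * (Ψ (a, x) * star (Ψ (b, y))) := by
    intro b
    rw [← hU, Finset.sum_mul]
    exact Finset.sum_congr rfl fun i _ => by ring
  simp only [this, ite_mul, one_mul, zero_mul, Finset.sum_ite_eq, Finset.mem_univ, if_true]

lemma traceFst_sum {ι m n : Type*} [Fintype ι] [Fintype m] (A : ι → Matrix (m × n) (m × n) ℂ) :
    traceFst (∑ i, A i) = ∑ i, traceFst (A i) := by
  ext x y
  simp only [traceFst, Matrix.of_apply, Matrix.sum_apply]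
  exact Finset.sum_comm

lemma sum_outcomeProb (U : Matrix.unitaryGroup (Fin 2) ℂ) (Ψ : Fin 2 × (Fin 2 × Fin 2) → ℂ)
    (hΨ : ∑ p, ‖Ψ p‖ ^ 2 = 1) :
    ∑ i, outcomeProb U (Matrix.vecMulVec Ψ (star Ψ)) i = 1 := by
  have h := congrArg (fun M : Matrix _ _ ℂ => M.trace.re) (sum_unnormalizedPostState U Ψ)
  simpa [Matrix.trace_sum, trace_unnormalizedPostState, trace_traceFst, trace_vecMulVec_star, hΨ,
    -Fin.sum_univ_two, -Matrix.trace_vecMulVec] using h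

lemma outcomeProb_nonneg (U : Matrix.unitaryGroup (Fin 2) ℂ) (Ψ : Fin 2 × (Fin 2 × Fin 2) → ℂ)
    (i : Fin 2) : 0 ≤ outcomeProb U (Matrix.vecMulVec Ψ (star Ψ)) i := by
  rw [outcomeProb_vecMulVec]
  positivity

/-- Each outcome contributes at most twice its probability to the average capacity, with equality
only if it leaves the receiver's qubit maximally mixed. -/
lemma outcomeProb_mul_capacity_le (U : Matrix.unitaryGroup (Fin 2) ℂ)
    (Ψ : Fin 2 × (Fin 2 × Fin 2) → ℂ) (i : Fin 2) :
    outcomeProb U (Matrix.vecMulVec Ψ (star Ψ)) i *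
        capacity (postState U (Matrix.vecMulVec Ψ (star Ψ)) i) ≤
          2 * outcomeProb U (Matrix.vecMulVec Ψ (star Ψ)) i ∧
      (outcomeProb U (Matrix.vecMulVec Ψ (star Ψ)) i *
        capacity (postState U (Matrix.vecMulVec Ψ (star Ψ)) i) =
          2 * outcomeProb U (Matrix.vecMulVec Ψ (star Ψ)) i ↔
        traceFst (unnormalizedPostState U (Matrix.vecMulVec Ψ (star Ψ)) i) =
          ((outcomeProb U (Matrix.vecMulVec Ψ (star Ψ)) i / 2 : ℝ) : ℂ) • 1) := by
  have hp0 := outcomeProb_nonneg U Ψ i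
  have hpv := outcomeProb_vecMulVec U Ψ i
  have hun := unnormalizedPostState_vecMulVec U Ψ i
  rw [postState]
  set p := outcomeProb U (Matrix.vecMulVec Ψ (star Ψ)) i
  set φ := postVec U Ψ i
  rw [hun]
  -- An outcome of probability zero has zero vector, and both sides of the equivalence hold
  -- trivially.
  rcases eq_or_ne p 0 with h0 | h0
  · have hφ : φ = 0 := by
      rw [h0] at hpv
      funext x
      have := (Finset.sum_eq_zero_iff_of_nonneg fun x _ => by positivity).1 hpv.symm x
        (Finset.mem_univ x)
      simpa using this
    have hT : traceFst (Matrix.vecMulVec φ (star φ)) = 0 := by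
      ext x y
      simp [traceFst, hφ]
    simp [h0, hT]
  · have hp : 0 < p := lt_of_le_of_ne hp0 (Ne.symm h0)
    -- Dividing by √p exhibits the normalised post-measurement state as pure, so its own entropy
    -- drops out of the capacity.
    set χ : Fin 2 × Fin 2 → ℂ := ((Real.sqrt p)⁻¹ : ℝ) • φ with hχ
    have hχφ : p⁻¹ • Matrix.vecMulVec φ (star φ) = Matrix.vecMulVec χ (star χ) := by
      rw [hχ]
      ext x y
      simp only [Matrix.smul_apply, Matrix.vecMulVec_apply, Pi.star_apply, Pi.smul_apply,
        Complex.real_smul, star_mul', Complex.star_def, Complex.conj_ofReal]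
      rw [show p⁻¹ = (Real.sqrt p)⁻¹ * (Real.sqrt p)⁻¹ by
        rw [← mul_inv, Real.mul_self_sqrt hp0]]
      push_cast
      ring
    have hχ1 : ∑ x, ‖χ x‖ ^ 2 = 1 := by
      simp only [hχ, Pi.smul_apply, norm_smul, mul_pow, ← Finset.mul_sum, ← hpv]
      rw [Real.norm_eq_abs, sq_abs, inv_pow, Real.sq_sqrt hp0, inv_mul_cancel₀ h0]
    have hherm : (traceFst (Matrix.vecMulVec χ (star χ))).IsHermitian :=
      isHermitian_traceFst _ (Matrix.posSemidef_vecMulVec_self_star χ).isHermitian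
    have htr : (traceFst (Matrix.vecMulVec χ (star χ))).trace = 1 := by
      rw [trace_traceFst, trace_vecMulVec_star, hχ1, Complex.ofReal_one]
    have hle := qubit_entropy_le_one hherm htr
    have heq := qubit_entropy_eq_one_iff hherm htr
    rw [hχφ, capacity, entropy_vecMulVec χ hχ1]
    refine ⟨by nlinarith, ?_⟩
    rw [show p * (1 + entropy (traceFst (Matrix.vecMulVec χ (star χ))) - 0) = 2 * p ↔
        entropy (traceFst (Matrix.vecMulVec χ (star χ))) = 1 from
      ⟨fun h => by
        have := mul_left_cancel₀ h0 (h.trans (mul_comm 2 p))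
        linarith, fun h => by rw [h]; ring⟩, heq, ← hχφ, traceFst_smul,
      inv_smul_eq_iff₀ h0]
    have : p • (1 / 2 : ℂ) • (1 : Matrix (Fin 2) (Fin 2) ℂ) = ((p / 2 : ℝ) : ℂ) • 1 := by
      ext x y
      simp
      ring
    rw [this]

/-! ### Maximal controlled capacity of a pure state -/

lemma averageCapacity_le_two (U : Matrix.unitaryGroup (Fin 2) ℂ)
    (Ψ : Fin 2 × (Fin 2 × Fin 2) → ℂ) (hΨ : ∑ p, ‖Ψ p‖ ^ 2 = 1) :
    averageCapacity U (Matrix.vecMulVec Ψ (star Ψ)) ≤ 2 := by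
  calc _ ≤ ∑ i, 2 * outcomeProb U (Matrix.vecMulVec Ψ (star Ψ)) i :=
        Finset.sum_le_sum fun i _ => (outcomeProb_mul_capacity_le U Ψ i).1
    _ = 2 := by rw [← Finset.mul_sum, sum_outcomeProb U Ψ hΨ, mul_one]

lemma averageCapacity_eq_two_iff (U : Matrix.unitaryGroup (Fin 2) ℂ)
    (Ψ : Fin 2 × (Fin 2 × Fin 2) → ℂ) (hΨ : ∑ p, ‖Ψ p‖ ^ 2 = 1) :
    averageCapacity U (Matrix.vecMulVec Ψ (star Ψ)) = 2 ↔
      ∀ i, traceFst (unnormalizedPostState U (Matrix.vecMulVec Ψ (star Ψ)) i) =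
          ((outcomeProb U (Matrix.vecMulVec Ψ (star Ψ)) i / 2 : ℝ) : ℂ) • 1 := by
  have h2 : ∑ i, 2 * outcomeProb U (Matrix.vecMulVec Ψ (star Ψ)) i = 2 := by
    rw [← Finset.mul_sum, sum_outcomeProb U Ψ hΨ, mul_one]
  conv_lhs => rw [averageCapacity, ← h2]
  rw [Finset.sum_eq_sum_iff_of_le fun i _ => (outcomeProb_mul_capacity_le U Ψ i).1]
  simp [fun i => (outcomeProb_mul_capacity_le U Ψ i).2, -Fin.forall_fin_two]

lemma controlledCapacity_le_two (Ψ : Fin 2 × (Fin 2 × Fin 2) → ℂ) (hΨ : ∑ p, ‖Ψ p‖ ^ 2 = 1) :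
    controlledCapacity (Matrix.vecMulVec Ψ (star Ψ)) ≤ 2 := by
  obtain ⟨U, -, hU⟩ :=
    exists_isMaxOn_averageCapacity _ (Matrix.posSemidef_vecMulVec_self_star Ψ)
  exact hU ▸ averageCapacity_le_two U Ψ hΨ

lemma controlledCapacity_eq_two_iff (Ψ : Fin 2 × (Fin 2 × Fin 2) → ℂ)
    (hΨ : ∑ p, ‖Ψ p‖ ^ 2 = 1) :
    controlledCapacity (Matrix.vecMulVec Ψ (star Ψ)) = 2 ↔
      ∃ U, ∀ i, traceFst (unnormalizedPostState U (Matrix.vecMulVec Ψ (star Ψ)) i) =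
          ((outcomeProb U (Matrix.vecMulVec Ψ (star Ψ)) i / 2 : ℝ) : ℂ) • 1 := by
  obtain ⟨U, hg, hU⟩ :=
    exists_isMaxOn_averageCapacity _ (Matrix.posSemidef_vecMulVec_self_star Ψ)
  simp_rw [← fun U => averageCapacity_eq_two_iff U Ψ hΨ]
  refine ⟨fun h => ⟨U, hU ▸ h⟩, fun ⟨V, hV⟩ => ?_⟩
  refine le_antisymm (controlledCapacity_le_two Ψ hΨ) ?_
  rw [hU, ← hV]
  exact hg.2 ⟨V, rfl⟩

lemma traceFst_traceFst_of_controlledCapacity_eq_two (Ψ : Fin 2 × (Fin 2 × Fin 2) → ℂ)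
    (hΨ : ∑ p, ‖Ψ p‖ ^ 2 = 1) (h : controlledCapacity (Matrix.vecMulVec Ψ (star Ψ)) = 2) :
    traceFst (traceFst (Matrix.vecMulVec Ψ (star Ψ))) = (1 / 2 : ℂ) • 1 := by
  obtain ⟨U, hU⟩ := (controlledCapacity_eq_two_iff Ψ hΨ).1 h
  have hs := sum_outcomeProb U Ψ hΨ
  rw [← sum_unnormalizedPostState U, traceFst_sum, Finset.sum_congr rfl fun i _ => hU i,
    ← Finset.sum_smul, ← Complex.ofReal_sum, ← Finset.sum_div, hs]
  norm_num

/-- Schmidt symmetry: with coefficient matrix M, the two marginals are M M† and the transpose of M†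
M. -/
lemma entropy_traceFst_eq_entropy_traceSnd {m n : Type*} [Fintype m] [DecidableEq m] [Fintype n]
    [DecidableEq n] (Ψ : m × n → ℂ) :
    entropy (traceFst (Matrix.vecMulVec Ψ (star Ψ))) =
      entropy (traceSnd (Matrix.vecMulVec Ψ (star Ψ))) := by
  set M : Matrix m n ℂ := Matrix.of fun a x => Ψ (a, x)
  have h1 : traceSnd (Matrix.vecMulVec Ψ (star Ψ)) = M * Mᴴ := by
    ext a b
    simp [traceSnd, M, Matrix.mul_apply, Matrix.vecMulVec_apply]
  have h2 : traceFst (Matrix.vecMulVec Ψ (star Ψ)) = (Mᴴ * M)ᵀ := by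
    ext a b
    simp [traceFst, M, Matrix.mul_apply, Matrix.vecMulVec_apply, mul_comm]
  rw [h1, h2, entropy_transpose (Matrix.isHermitian_conjTranspose_mul_self M),
    entropy_mul_conjTranspose_comm]

/-! ### Reduced states and control powers of three-qubit states -/

/-- The basis state with qubits `σ 0`, `σ 1`, `σ 2` in the given states. -/
def qubitEquiv (σ : Equiv.Perm (Fin 3)) : Fin 2 × (Fin 2 × Fin 2) ≃ (Fin 3 → Fin 2) where
  toFun p i := ![p.1, p.2.1, p.2.2] (σ.symm i)
  invFun f := (f (σ 0), f (σ 1), f (σ 2))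
  left_inv p := by simp
  right_inv f := by
    funext i
    obtain ⟨m, rfl⟩ := σ.surjective i
    fin_cases m <;> simp

/-- The reduced state of qubit `i`. -/
def reducedState (ρ : ThreeQubitOp) (i : Fin 3) : Matrix (Fin 2) (Fin 2) ℂ :=
  Matrix.of fun a b => ∑ f : Fin 3 → Fin 2, if f i = a then ρ f (Function.update f i b) else 0

/-- Reindexing by an arbitrary `σ` lets marginals from different distributions be identified with
one `σ`-free matrix. -/
lemma reducedState_apply (ρ : ThreeQubitOp) (σ : Equiv.Perm (Fin 3)) (i : Fin 3) (a b : Fin 2) :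
    reducedState ρ i a b = ∑ p : Fin 2 × (Fin 2 × Fin 2), if qubitEquiv σ p i = a then
      ρ (qubitEquiv σ p) (Function.update (qubitEquiv σ p) i b) else 0 :=
  ((qubitEquiv σ).sum_comp fun f => if f i = a then ρ f (Function.update f i b) else 0).symm

lemma update_qubitEquiv_fst (σ : Equiv.Perm (Fin 3)) (p : Fin 2 × (Fin 2 × Fin 2)) (b : Fin 2) :
    Function.update (qubitEquiv σ p) (σ 0) b = qubitEquiv σ (b, p.2) := by
  funext i
  obtain ⟨m, rfl⟩ := σ.surjective i
  fin_cases m <;> simp [qubitEquiv]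

lemma update_qubitEquiv_snd_snd (σ : Equiv.Perm (Fin 3)) (p : Fin 2 × (Fin 2 × Fin 2))
    (b : Fin 2) :
    Function.update (qubitEquiv σ p) (σ 2) b = qubitEquiv σ (p.1, p.2.1, b) := by
  funext i
  obtain ⟨m, rfl⟩ := σ.surjective i
  fin_cases m <;> simp [qubitEquiv]

lemma traceSnd_distribute (σ : Equiv.Perm (Fin 3)) (ρ : ThreeQubitOp) :
    traceSnd (distribute σ ρ) = reducedState ρ (σ 0) := by
  ext a b
  rw [reducedState_apply ρ σ, Fintype.sum_prod_type]
  simp only [update_qubitEquiv_fst]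
  have h : ∀ x y, qubitEquiv σ (x, y) (σ 0) = x := fun x y => by simp [qubitEquiv]
  simp only [h, Finset.sum_ite_irrel, Finset.sum_const_zero, Finset.sum_ite_eq', Finset.mem_univ,
    if_true]
  rfl

lemma traceFst_traceFst_distribute (σ : Equiv.Perm (Fin 3)) (ρ : ThreeQubitOp) :
    traceFst (traceFst (distribute σ ρ)) = reducedState ρ (σ 2) := by
  ext a b
  rw [reducedState_apply ρ σ, Fintype.sum_prod_type, Finset.sum_congr rfl fun x _ =>
    Fintype.sum_prod_type _, Finset.sum_comm]
  simp only [update_qubitEquiv_snd_snd]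
  have h : ∀ x y z, qubitEquiv σ (x, y, z) (σ 2) = z := fun x y z => by simp [qubitEquiv]
  simp only [h, Finset.sum_ite_eq', Finset.mem_univ, if_true]
  rfl

lemma distribute_vecMulVec (σ : Equiv.Perm (Fin 3)) (ψ : (Fin 3 → Fin 2) → ℂ) :
    distribute σ (Matrix.vecMulVec ψ (star ψ)) =
      Matrix.vecMulVec (ψ ∘ qubitEquiv σ) (star (ψ ∘ qubitEquiv σ)) := rfl

lemma sum_norm_sq_comp_qubitEquiv (σ : Equiv.Perm (Fin 3)) (ψ : (Fin 3 → Fin 2) → ℂ) :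
    ∑ p, ‖(ψ ∘ qubitEquiv σ) p‖ ^ 2 = ∑ f, ‖ψ f‖ ^ 2 :=
  (qubitEquiv σ).sum_comp fun f => ‖ψ f‖ ^ 2

lemma controlPower_vecMulVec (σ : Equiv.Perm (Fin 3)) (ψ : (Fin 3 → Fin 2) → ℂ) :
    controlPower σ (Matrix.vecMulVec ψ (star ψ)) =
      controlledCapacity (distribute σ (Matrix.vecMulVec ψ (star ψ))) -
        (1 + entropy (reducedState (Matrix.vecMulVec ψ (star ψ)) (σ 2)) -
          entropy (reducedState (Matrix.vecMulVec ψ (star ψ)) (σ 0))) := by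
  rw [controlPower, capacity, traceFst_traceFst_distribute, ← traceSnd_distribute σ,
    distribute_vecMulVec, entropy_traceFst_eq_entropy_traceSnd]

lemma controlledCapacity_distribute_le_two (σ : Equiv.Perm (Fin 3)) (ψ : (Fin 3 → Fin 2) → ℂ)
    (hψ : ∑ f, ‖ψ f‖ ^ 2 = 1) :
    controlledCapacity (distribute σ (Matrix.vecMulVec ψ (star ψ))) ≤ 2 := by
  rw [distribute_vecMulVec]
  exact controlledCapacity_le_two _ ((sum_norm_sq_comp_qubitEquiv σ ψ).trans hψ)

lemma reducedState_of_controlledCapacity_eq_two (σ : Equiv.Perm (Fin 3))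
    (ψ : (Fin 3 → Fin 2) → ℂ) (hψ : ∑ f, ‖ψ f‖ ^ 2 = 1)
    (h : controlledCapacity (distribute σ (Matrix.vecMulVec ψ (star ψ))) = 2) :
    reducedState (Matrix.vecMulVec ψ (star ψ)) (σ 2) = (1 / 2 : ℂ) • 1 := by
  rw [← traceFst_traceFst_distribute σ]
  exact traceFst_traceFst_of_controlledCapacity_eq_two _
    ((sum_norm_sq_comp_qubitEquiv σ ψ).trans hψ) h

lemma trace_reducedState (ψ : (Fin 3 → Fin 2) → ℂ) (hψ : ∑ f, ‖ψ f‖ ^ 2 = 1) (i : Fin 3) :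
    (reducedState (Matrix.vecMulVec ψ (star ψ)) i).trace = 1 := by
  have h2 : Equiv.swap i 2 2 = i := Equiv.swap_apply_right i 2
  conv_lhs => rw [← h2]
  rw [← traceFst_traceFst_distribute, trace_traceFst, trace_traceFst, distribute_vecMulVec,
    trace_vecMulVec_star, sum_norm_sq_comp_qubitEquiv, hψ, Complex.ofReal_one]

lemma isHermitian_reducedState (ψ : (Fin 3 → Fin 2) → ℂ) (i : Fin 3) :
    (reducedState (Matrix.vecMulVec ψ (star ψ)) i).IsHermitian := by
  have h2 : Equiv.swap i 2 2 = i := Equiv.swap_apply_right i 2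
  rw [← h2, ← traceFst_traceFst_distribute, distribute_vecMulVec]
  exact isHermitian_traceFst _ (isHermitian_traceFst _
    (Matrix.posSemidef_vecMulVec_self_star _).isHermitian)

/-- Minimal control power one is equivalent to all controlled capacities being maximal. -/
lemma minimalControlPower_eq_one_iff (ψ : (Fin 3 → Fin 2) → ℂ) (hψ : ∑ f, ‖ψ f‖ ^ 2 = 1) :
    minimalControlPower (Matrix.vecMulVec ψ (star ψ)) = 1 ↔
      ∀ σ, controlledCapacity (distribute σ (Matrix.vecMulVec ψ (star ψ))) = 2 := by
  constructor
  · intro h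
    have hge : ∀ σ, 1 ≤ controlPower σ (Matrix.vecMulVec ψ (star ψ)) := fun σ =>
      h ▸ Finset.inf'_le _ (Finset.mem_univ σ)
    simp only [controlPower_vecMulVec] at hge
    have hle := fun σ => controlledCapacity_distribute_le_two σ ψ hψ
    have hs := fun i => qubit_entropy_le_one (isHermitian_reducedState ψ i)
      (trace_reducedState ψ hψ i)
    -- Let the qubit m of least entropy control: the capacity is at least 2 + S(ρ_l) - S(ρ_m) ≥ 2,
    -- hence equal to 2. Then S(ρ_l) = 1, and the same inequality gives S(ρ_m) ≥ 1.
    obtain ⟨m, hm⟩ := Finite.exists_min fun i =>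
      entropy (reducedState (Matrix.vecMulVec ψ (star ψ)) i)
    have hm1 : 1 ≤ entropy (reducedState (Matrix.vecMulVec ψ (star ψ)) m) := by
      have h0 : Equiv.swap 0 m 0 = m := Equiv.swap_apply_left 0 m
      have h1 := hge (Equiv.swap 0 m)
      rw [h0] at h1
      have h2 := hm (Equiv.swap 0 m 2)
      have h3 : controlledCapacity
          (distribute (Equiv.swap 0 m) (Matrix.vecMulVec ψ (star ψ))) = 2 :=
        le_antisymm (hle _) (by linarith)
      rw [h3, reducedState_of_controlledCapacity_eq_two _ ψ hψ h3, entropy_half_one] at h1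
      linarith
    -- All entropies are at least S(ρ_m) ≥ 1 and at most 1, so the entropy terms cancel for every
    -- distribution.
    intro σ
    have h1 := hge σ
    have h2 := hm (σ 2)
    have h3 := hs (σ 0)
    exact le_antisymm (hle σ) (by linarith)
  · intro h
    have hs : ∀ i, entropy (reducedState (Matrix.vecMulVec ψ (star ψ)) i) = 1 := by
      intro i
      have h2 : Equiv.swap i 2 2 = i := Equiv.swap_apply_right i 2
      rw [← h2, reducedState_of_controlledCapacity_eq_two _ ψ hψ (h _), entropy_half_one]
    have hc : ∀ σ, controlPower σ (Matrix.vecMulVec ψ (star ψ)) = 1 := by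
      intro σ
      rw [controlPower_vecMulVec, h, hs, hs]
      norm_num
    simp [minimalControlPower, hc]

/-! ### Traceless unitary qubit operators -/

/-- By Cayley–Hamilton B² = -det B. With μ² = -det B, unitarity gives B† = μ⁻²B, so μ⁻¹B is
Hermitian with trace 0 and determinant -1. The Hermitian spectral theorem applies to it, with
eigenvalues ±1. -/
lemma exists_diagonalization_of_trace_eq_zero {B : Matrix (Fin 2) (Fin 2) ℂ}
    (hB : B ∈ Matrix.unitaryGroup (Fin 2) ℂ) (ht : B.trace = 0) :
    ∃ V ∈ Matrix.unitaryGroup (Fin 2) ℂ, ∃ e : ℂ, ‖e‖ = 1 ∧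
      B = V * Matrix.diagonal ![e, -e] * Vᴴ := by
  have hdet : ‖B.det‖ = 1 := by
    have := congrArg Matrix.det (Matrix.mem_unitaryGroup_iff.1 hB)
    rw [Matrix.det_mul, Matrix.star_eq_conjTranspose, Matrix.det_conjTranspose, Matrix.det_one,
      Complex.star_def, Complex.mul_conj'] at this
    have h2 : ‖B.det‖ ^ 2 = 1 := by exact_mod_cast this
    exact (pow_eq_one_iff_of_nonneg (norm_nonneg _) two_ne_zero).1 h2
  obtain ⟨μ, hμ⟩ := IsAlgClosed.exists_pow_nat_eq (-B.det) (n := 2) two_pos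
  have hμ1 : ‖μ‖ = 1 := by
    have : ‖μ‖ ^ 2 = 1 := by rw [← norm_pow, hμ, norm_neg, hdet]
    exact (pow_eq_one_iff_of_nonneg (norm_nonneg _) two_ne_zero).1 this
  have hμ0 : μ ≠ 0 := fun h => by simp [h] at hμ1
  have hBB : B * B = μ ^ 2 • (1 : Matrix (Fin 2) (Fin 2) ℂ) := by
    rw [hμ]
    rw [Matrix.trace_fin_two] at ht
    have h11 : B 1 1 = -B 0 0 := by linear_combination ht
    ext i j
    fin_cases i <;> fin_cases j <;>
      simp [Matrix.mul_apply, Fin.sum_univ_two, Matrix.det_fin_two, h11] <;> ring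
  have hBs : Bᴴ = (μ ^ 2)⁻¹ • B := by
    have h1 : Bᴴ * B = 1 := Matrix.mem_unitaryGroup_iff'.1 hB
    have h2 : Bᴴ * (B * B) = B := by rw [← mul_assoc, h1, one_mul]
    rw [hBB, mul_smul_comm, mul_one] at h2
    rw [eq_inv_smul_iff₀ (pow_ne_zero 2 hμ0), h2]
  have hμs : star μ = μ⁻¹ := by
    rw [Complex.star_def, ← Complex.inv_eq_conj hμ1]
  have hR : (μ⁻¹ • B).IsHermitian := by
    rw [Matrix.IsHermitian, Matrix.conjTranspose_smul, hBs, smul_smul, star_inv₀, hμs]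
    congr 1
    field_simp
  have hspec := hR.spectral_theorem
  have htr := hR.trace_eq_sum_eigenvalues
  have hd := hR.det_eq_prod_eigenvalues
  rw [Matrix.trace_smul, ht, smul_zero, Fin.sum_univ_two] at htr
  rw [Matrix.det_smul, Fin.prod_univ_two, Fintype.card_fin] at hd
  set d := hR.eigenvalues
  have h10 : ((d 1 : ℝ) : ℂ) = -(d 0 : ℝ) := by
    simp only [Complex.coe_algebraMap] at htr
    linear_combination -htr
  have hd0 : ‖((d 0 : ℝ) : ℂ)‖ = 1 := by
    have h3 : ((d 0 : ℝ) : ℂ) ^ 2 = 1 := by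
      have hdet' : B.det = -μ ^ 2 := by rw [hμ, neg_neg]
      simp only [Complex.coe_algebraMap] at hd
      rw [h10, hdet'] at hd
      have : (μ⁻¹) ^ 2 * -μ ^ 2 = -1 := by field_simp
      rw [this] at hd
      linear_combination hd
    have h4 : ‖((d 0 : ℝ) : ℂ)‖ ^ 2 = 1 := by rw [← norm_pow, h3, norm_one]
    exact (pow_eq_one_iff_of_nonneg (norm_nonneg _) two_ne_zero).1 h4
  refine ⟨hR.eigenvectorUnitary, hR.eigenvectorUnitary.2, μ * (d 0 : ℝ), ?_, ?_⟩
  · rw [norm_mul, hμ1, hd0, one_mul]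
  · have hdiag : Matrix.diagonal ![μ * ((d 0 : ℝ) : ℂ), -(μ * (d 0 : ℝ))] =
        μ • Matrix.diagonal (RCLike.ofReal ∘ d : Fin 2 → ℂ) := by
      ext i j
      fin_cases i <;> fin_cases j <;> simp [h10]
    rw [Unitary.conjStarAlgAut_apply] at hspec
    rw [hdiag, mul_smul_comm, smul_mul_assoc, ← Matrix.star_eq_conjTranspose, ← hspec, smul_smul,
      mul_inv_cancel₀ hμ0, one_smul]

/-- The rows hold the diagonals of the two outcomes, (1, 1) and (e, -e); e = 1 is the Hadamard
matrix. -/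
lemma hadamardPhase_mem_unitaryGroup {e : ℂ} (he : ‖e‖ = 1) :
    (((Real.sqrt 2)⁻¹ : ℝ) : ℂ) • !![1, 1; e, -e] ∈ Matrix.unitaryGroup (Fin 2) ℂ := by
  have h2 : ((Real.sqrt 2 : ℝ) : ℂ)⁻¹ * ((Real.sqrt 2 : ℝ) : ℂ)⁻¹ = 1 / 2 := by
    rw [← mul_inv, ← Complex.ofReal_mul, Real.mul_self_sqrt zero_le_two]
    norm_num
  have h3 : e * star e = 1 := by
    rw [Complex.star_def, Complex.mul_conj', he]
    norm_num
  rw [Complex.star_def] at h3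
  rw [Matrix.mem_unitaryGroup_iff]
  ext i j
  fin_cases i <;> fin_cases j <;>
    simp [Matrix.mul_apply, Fin.sum_univ_two, Matrix.star_apply]
  · linear_combination 2 * h2
  · linear_combination 2 * h2 * e * (starRingEnd ℂ) e + h3

/-! ### Amplitudes of states in the local unitary orbit of the GHZ state -/

/-- Amplitudes of the image of the GHZ vector under `A ⊗ B ⊗ C`. -/
def ghzAmplitude (A B C : Matrix (Fin 2) (Fin 2) ℂ) : Fin 2 × (Fin 2 × Fin 2) → ℂ :=
  fun p => (((Real.sqrt 2)⁻¹ : ℝ) : ℂ) * ∑ t, A p.1 t * B p.2.1 t * C p.2.2 t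

lemma inv_sqrt_two_mul_self :
    (((Real.sqrt 2)⁻¹ : ℝ) : ℂ) * (((Real.sqrt 2)⁻¹ : ℝ) : ℂ) = 1 / 2 := by
  rw [← Complex.ofReal_mul, ← mul_inv, Real.mul_self_sqrt zero_le_two]
  norm_num

lemma traceFst_vecMulVec {m n : Type*} [Fintype m] (φ : m × n → ℂ) :
    traceFst (Matrix.vecMulVec φ (star φ)) =
      (Matrix.of fun c b => φ (b, c)) * (Matrix.of fun c b => φ (b, c))ᴴ := by
  ext x y
  simp [traceFst, Matrix.mul_apply, Matrix.vecMulVec_apply]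

lemma postVec_ghzAmplitude (V : Matrix.unitaryGroup (Fin 2) ℂ) (A B C : Matrix (Fin 2) (Fin 2) ℂ)
    (i : Fin 2) :
    (Matrix.of fun c b => postVec V (ghzAmplitude A B C) i (b, c)) =
      (((Real.sqrt 2)⁻¹ : ℝ) : ℂ) •
        (C * Matrix.diagonal (fun t => ((V : Matrix (Fin 2) (Fin 2) ℂ) * A) i t) * Bᵀ) := by
  ext c b
  simp only [postVec, ghzAmplitude, Matrix.of_apply, Matrix.smul_apply, Matrix.mul_apply,
    Matrix.transpose_apply, Matrix.diagonal_apply, Fin.sum_univ_two, smul_eq_mul]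
  simp
  ring

/-- The controller undoes `A` and measures in the Hadamard basis. The diagonal factor in
`postVec_ghzAmplitude` is then unitary up to 1/√2, so each outcome leaves a maximally entangled
pair. -/
lemma controlledCapacity_ghzAmplitude (A B C : Matrix.unitaryGroup (Fin 2) ℂ)
    (hΨ : ∑ p, ‖ghzAmplitude A B C p‖ ^ 2 = 1) :
    controlledCapacity
      (Matrix.vecMulVec (ghzAmplitude A B C) (star (ghzAmplitude A B C))) = 2 := by
  set H : Matrix.unitaryGroup (Fin 2) ℂ := ⟨_, hadamardPhase_mem_unitaryGroup (norm_one (α := ℂ))⟩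
    with hH
  refine (controlledCapacity_eq_two_iff _ hΨ).2 ⟨H * star A, fun i => ?_⟩
  have hHA : ((H * star A : Matrix.unitaryGroup (Fin 2) ℂ) : Matrix (Fin 2) (Fin 2) ℂ) * A = H := by
    have : H * star A * A = H := by rw [mul_assoc, Unitary.star_mul_self, mul_one]
    exact congrArg Subtype.val this
  have hB : (B : Matrix (Fin 2) (Fin 2) ℂ)ᵀ * (B : Matrix (Fin 2) (Fin 2) ℂ)ᵀᴴ = 1 := by
    have : (B : Matrix (Fin 2) (Fin 2) ℂ)ᴴ * B = 1 := Matrix.mem_unitaryGroup_iff'.1 B.2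
    rw [show (B : Matrix (Fin 2) (Fin 2) ℂ)ᵀᴴ = (B : Matrix (Fin 2) (Fin 2) ℂ)ᴴᵀ from rfl,
      ← Matrix.transpose_mul, this, Matrix.transpose_one]
  have hC : (C : Matrix (Fin 2) (Fin 2) ℂ) * (C : Matrix (Fin 2) (Fin 2) ℂ)ᴴ = 1 :=
    Matrix.mem_unitaryGroup_iff.1 C.2
  have hD : Matrix.diagonal (fun t => (H : Matrix (Fin 2) (Fin 2) ℂ) i t) *
      (Matrix.diagonal (fun t => (H : Matrix (Fin 2) (Fin 2) ℂ) i t))ᴴ = (1 / 2 : ℂ) • 1 := by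
    rw [Matrix.diagonal_conjTranspose, Matrix.diagonal_mul_diagonal, Matrix.smul_one_eq_diagonal]
    congr 1
    funext t
    rw [← inv_sqrt_two_mul_self]
    fin_cases i <;> fin_cases t <;> simp [hH]
  have hT : traceFst (unnormalizedPostState (H * star A)
      (Matrix.vecMulVec (ghzAmplitude A B C) (star (ghzAmplitude A B C))) i) =
        (1 / 4 : ℂ) • 1 := by
    rw [unnormalizedPostState_vecMulVec, traceFst_vecMulVec, postVec_ghzAmplitude, hHA,
      Matrix.conjTranspose_smul, Complex.star_def, Complex.conj_ofReal, smul_mul_smul_comm,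
      inv_sqrt_two_mul_self, Matrix.conjTranspose_mul, Matrix.conjTranspose_mul]
    have : ∀ C D B : Matrix (Fin 2) (Fin 2) ℂ, C * D * B * (Bᴴ * (Dᴴ * Cᴴ)) =
        C * (D * (B * Bᴴ) * Dᴴ) * Cᴴ := fun C D B => by noncomm_ring
    rw [this, hB, mul_one, hD, mul_smul_comm, mul_one, smul_mul_assoc, hC, smul_smul]
    norm_num
  have hp : outcomeProb (H * star A)
      (Matrix.vecMulVec (ghzAmplitude A B C) (star (ghzAmplitude A B C))) i = 1 / 2 := by
    rw [← trace_unnormalizedPostState, ← trace_traceFst, hT]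
    simp [Matrix.trace_smul]
    norm_num
  rw [hT, hp]
  norm_num

/-- The entries are inner products of post-measurement vectors; off the diagonal they express
orthogonality of the outcomes. -/
lemma conj_traceSnd_apply (U : Matrix (Fin 2) (Fin 2) ℂ) (Ψ : Fin 2 × (Fin 2 × Fin 2) → ℂ)
    (i j : Fin 2) :
    (U * traceSnd (Matrix.vecMulVec Ψ (star Ψ)) * Uᴴ) i j =
      ∑ x, (∑ a, U i a * Ψ (a, x)) * star (∑ a, U j a * Ψ (a, x)) := by
  set M : Matrix (Fin 2) (Fin 2 × Fin 2) ℂ := Matrix.of fun a x => Ψ (a, x) with hM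
  have h : traceSnd (Matrix.vecMulVec Ψ (star Ψ)) = M * Mᴴ := by
    ext a b
    simp [traceSnd, M, Matrix.mul_apply, Matrix.vecMulVec_apply]
  have h2 : U * (M * Mᴴ) * Uᴴ = (U * M) * (U * M)ᴴ := by
    rw [Matrix.conjTranspose_mul]
    simp only [Matrix.mul_assoc]
  rw [h, h2, Matrix.mul_apply]
  rfl

/-- A unit vector whose first qubit is maximally mixed and whose controlled capacity is two is
locally equivalent to the GHZ vector. -/
lemma exists_eq_ghzAmplitude (Ψ : Fin 2 × (Fin 2 × Fin 2) → ℂ) (hΨ : ∑ p, ‖Ψ p‖ ^ 2 = 1)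
    (h1 : traceSnd (Matrix.vecMulVec Ψ (star Ψ)) = (1 / 2 : ℂ) • 1)
    (h2 : controlledCapacity (Matrix.vecMulVec Ψ (star Ψ)) = 2) :
    ∃ A B C : Matrix.unitaryGroup (Fin 2) ℂ, Ψ = ghzAmplitude A B C := by
  obtain ⟨U, hU⟩ := (controlledCapacity_eq_two_iff Ψ hΨ).1 h2
  have hUU : (U : Matrix (Fin 2) (Fin 2) ℂ) * (U : Matrix (Fin 2) (Fin 2) ℂ)ᴴ = 1 :=
    Matrix.mem_unitaryGroup_iff.1 U.2
  have hUU' : (U : Matrix (Fin 2) (Fin 2) ℂ)ᴴ * (U : Matrix (Fin 2) (Fin 2) ℂ) = 1 :=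
    Matrix.mem_unitaryGroup_iff'.1 U.2
  have hconj : (U : Matrix (Fin 2) (Fin 2) ℂ) * traceSnd (Matrix.vecMulVec Ψ (star Ψ)) *
      (U : Matrix (Fin 2) (Fin 2) ℂ)ᴴ = (1 / 2 : ℂ) • 1 := by
    rw [h1, mul_smul_comm, mul_one, smul_mul_assoc, hUU]
  have hp : ∀ i, outcomeProb U (Matrix.vecMulVec Ψ (star Ψ)) i = 1 / 2 := by
    intro i
    rw [outcomeProb, hconj]
    simp
  -- Each outcome has probability 1/2 and receiver state (1/4)·1 before normalisation, so the factor
  -- 2 makes the coefficient matrix unitary.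
  set N : Fin 2 → Matrix (Fin 2) (Fin 2) ℂ := fun i =>
    (2 : ℂ) • Matrix.of fun c b => postVec U Ψ i (b, c) with hN
  have hNu : ∀ i, N i ∈ Matrix.unitaryGroup (Fin 2) ℂ := by
    intro i
    have h := hU i
    rw [unnormalizedPostState_vecMulVec, traceFst_vecMulVec, hp] at h
    rw [Matrix.mem_unitaryGroup_iff, Matrix.star_eq_conjTranspose, hN, Matrix.conjTranspose_smul,
      smul_mul_smul_comm, h, smul_smul]
    have : (2 * star 2 * ((1 / 2 / 2 : ℝ) : ℂ) : ℂ) = 1 := by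
      simp
      norm_num
    rw [this, one_smul]
  -- This is four times the vanishing (1, 0) entry of U ρ_j U†.
  have htr : ((N 0)ᴴ * N 1).trace = 0 := by
    have h := congrFun (congrFun hconj 1) 0
    rw [conj_traceSnd_apply] at h
    simp only [Fintype.sum_prod_type] at h
    simp only [hN, postVec, Matrix.trace, Matrix.diag, Matrix.mul_apply,
      Matrix.conjTranspose_apply, Matrix.smul_apply, Matrix.of_apply, smul_eq_mul, star_mul',
      Fin.sum_univ_two] at h ⊢
    simp at h ⊢
    linear_combination 4 * h
  obtain ⟨V, hV, e, he, hB⟩ :=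
    exists_diagonalization_of_trace_eq_zero (mul_mem (Unitary.star_mem (hNu 0)) (hNu 1)) htr
  have hVV : V * Vᴴ = 1 := Matrix.mem_unitaryGroup_iff.1 hV
  have hN0 : N 0 = N 0 * V * Vᴴ := by rw [mul_assoc, hVV, mul_one]
  have hN1 : N 1 = N 0 * V * Matrix.diagonal ![e, -e] * Vᴴ := by
    have h3 : N 0 * star (N 0) = 1 := Matrix.mem_unitaryGroup_iff.1 (hNu 0)
    rw [mul_assoc (N 0), mul_assoc (N 0), ← hB, ← mul_assoc, h3, one_mul]
  have hE := hadamardPhase_mem_unitaryGroup he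
  have hVt : Vᴴᵀ ∈ Matrix.unitaryGroup (Fin 2) ℂ := by
    have h : Vᴴ * V = 1 := Matrix.mem_unitaryGroup_iff'.1 hV
    rw [Matrix.mem_unitaryGroup_iff', Matrix.star_eq_conjTranspose,
      show Vᴴᵀᴴ = Vᴴᴴᵀ from rfl, ← Matrix.transpose_mul, Matrix.conjTranspose_conjTranspose,
      h, Matrix.transpose_one]
  -- Both outcomes are diagonal in the same bases: columns of `N 0 * V` for the receiver, of the
  -- entrywise conjugate of `V` for the sender.
  have hφ : ∀ i x, postVec U Ψ i x = (1 / 2) * ∑ t, !![1, 1; e, -e] i t * Vᴴᵀ x.1 t *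
      (N 0 * V) x.2 t := by
    intro i x
    have hx : postVec U Ψ i x = (1 / 2) * N i x.2 x.1 := by simp [hN]
    rw [hx]
    fin_cases i
    · have h := congrFun (congrFun hN0 x.2) x.1
      rw [Matrix.mul_apply] at h
      simp only [Fin.zero_eta]
      rw [h]
      simp [Fin.sum_univ_two]
      ring
    · have h := congrFun (congrFun hN1 x.2) x.1
      rw [Matrix.mul_apply] at h
      simp only [Fin.mk_one]
      rw [h]
      simp [Matrix.mul_diagonal, Fin.sum_univ_two]
      ring
  have hinv : ∀ a x, Ψ (a, x) =
      ∑ i, (U : Matrix (Fin 2) (Fin 2) ℂ)ᴴ a i * postVec U Ψ i x := by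
    intro a x
    set M : Matrix (Fin 2) (Fin 2 × Fin 2) ℂ := Matrix.of fun a x => Ψ (a, x) with hM
    have h : (U : Matrix (Fin 2) (Fin 2) ℂ)ᴴ * ((U : Matrix (Fin 2) (Fin 2) ℂ) * M) = M := by
      rw [← Matrix.mul_assoc, hUU', Matrix.one_mul]
    exact (congrFun (congrFun h a) x).symm
  -- Undoing the measurement rotation multiplies the phase matrix by U†; the prefactor 1/2 splits
  -- into 1/√2 for that matrix and 1/√2 for GHZ.
  refine ⟨star U * ⟨_, hE⟩, ⟨_, hVt⟩, ⟨_, mul_mem (hNu 0) hV⟩, ?_⟩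
  funext ⟨a, b, c⟩
  rw [hinv]
  simp only [hφ, ← inv_sqrt_two_mul_self, ghzAmplitude, Submonoid.coe_mul, Matrix.mul_apply,
    Matrix.smul_apply, smul_eq_mul, Fin.sum_univ_two, Unitary.coe_star,
    Matrix.star_eq_conjTranspose]
  ring

/-! ### The GHZ orbit -/

lemma localUnitary_mulVec_ghzVector (U : Fin 3 → Matrix.unitaryGroup (Fin 2) ℂ)
    (f : Fin 3 → Fin 2) :
    (localUnitary U *ᵥ ghzVector) f = (((Real.sqrt 2)⁻¹ : ℝ) : ℂ) *
      ∑ t, ∏ i, (U i : Matrix (Fin 2) (Fin 2) ℂ) (f i) t := by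
  simp [ghzVector, Matrix.mulVec_smul, Matrix.mulVec_add, localUnitary, Fin.sum_univ_two, mul_add]

lemma localUnitary_mul_ghzState (U : Fin 3 → Matrix.unitaryGroup (Fin 2) ℂ) :
    localUnitary U * ghzState * (localUnitary U)ᴴ =
      Matrix.vecMulVec (localUnitary U *ᵥ ghzVector) (star (localUnitary U *ᵥ ghzVector)) := by
  rw [ghzState, Matrix.mul_vecMulVec, Matrix.vecMulVec_mul, ← Matrix.star_mulVec]

lemma localUnitary_mulVec_ghzVector_comp_qubitEquiv (U : Fin 3 → Matrix.unitaryGroup (Fin 2) ℂ)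
    (σ : Equiv.Perm (Fin 3)) :
    (localUnitary U *ᵥ ghzVector) ∘ qubitEquiv σ =
      ghzAmplitude (U (σ 0)) (U (σ 1)) (U (σ 2)) := by
  funext p
  rw [Function.comp_apply, localUnitary_mulVec_ghzVector, ghzAmplitude]
  congr 1
  refine Finset.sum_congr rfl fun t _ => ?_
  rw [← Equiv.prod_comp σ, Fin.prod_univ_three]
  simp [qubitEquiv]

end ControlledDenseCoding

end

theorem proposition4 (ρ : ControlledDenseCoding.ThreeQubitOp)
    (hρ : ControlledDenseCoding.IsPureState ρ) :
    ControlledDenseCoding.minimalControlPower ρ = 1 ↔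
      ∃ U : Fin 3 → Matrix.unitaryGroup (Fin 2) ℂ,
        ρ = ControlledDenseCoding.localUnitary U * ControlledDenseCoding.ghzState *
          (ControlledDenseCoding.localUnitary U)ᴴ := by
  open ControlledDenseCoding in
  obtain ⟨ψ, hψ, rfl⟩ := hρ
  constructor
  · intro h
    rw [minimalControlPower_eq_one_iff ψ hψ] at h
    -- Swapping qubits 0 and 2 makes qubit 0 the receiver, which shows that it is maximally mixed.
    have hred := reducedState_of_controlledCapacity_eq_two (Equiv.swap 0 2) ψ hψ (h _)
    have h1 := traceSnd_distribute 1 (Matrix.vecMulVec ψ (star ψ))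
    rw [Equiv.swap_apply_right] at hred
    rw [Equiv.Perm.one_apply, hred, distribute_vecMulVec] at h1
    have h2 := h 1
    rw [distribute_vecMulVec] at h2
    obtain ⟨A, B, C, hABC⟩ := exists_eq_ghzAmplitude _
      ((sum_norm_sq_comp_qubitEquiv 1 ψ).trans hψ) h1 h2
    refine ⟨![A, B, C], ?_⟩
    have hf : ψ = localUnitary ![A, B, C] *ᵥ ghzVector := by
      refine (qubitEquiv 1).surjective.injective_comp_right ?_
      change ψ ∘ qubitEquiv 1 = (localUnitary ![A, B, C] *ᵥ ghzVector) ∘ qubitEquiv 1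
      rw [hABC, localUnitary_mulVec_ghzVector_comp_qubitEquiv]
      rfl
    rw [localUnitary_mul_ghzState, ← hf]
  · rintro ⟨U, hU⟩
    rw [localUnitary_mul_ghzState] at hU
    -- Normalisation is inherited from `ψ` by comparing traces.
    have hφ : ∑ f, ‖(localUnitary U *ᵥ ghzVector) f‖ ^ 2 = 1 := by
      have h := congrArg Matrix.trace hU
      rw [trace_vecMulVec_star, trace_vecMulVec_star, hψ] at h
      exact_mod_cast h.symm
    rw [hU, minimalControlPower_eq_one_iff _ hφ]
    intro σ
    have hσ := sum_norm_sq_comp_qubitEquiv σ (localUnitary U *ᵥ ghzVector)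
    rw [localUnitary_mulVec_ghzVector_comp_qubitEquiv] at hσ
    rw [distribute_vecMulVec, localUnitary_mulVec_ghzVector_comp_qubitEquiv]
    exact controlledCapacity_ghzAmplitude _ _ _ (hσ.trans hφ)
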